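/- Let $n \ge 3$ and let $\boldsymbol{a} = (a_1, \ldots, a_n)^T$ be a vector of positive integers with $a_1 \le a_2 \le \cdots \le a_n$ and $\gcd(a_i,a_j)=1$ for all $i \ne j$. Let $$F(\boldsymbol{a}) := \max\{ b \in \mathbb{Z} : b \ne \boldsymbol{a}^T \boldsymbol{z} \text{ for all } \boldsymbol{z} \in \mathbb{Z}^n_{\ge 0}\}$$ be the Frobenius number of $\boldsymbol{a}$ (so $F(\boldsymbol a)=-1$ if $a_1=1$), and put $$UB_1(\boldsymbol{a}) := \tfrac12\Big(\sqrt{\tfrac13 (a_1+a_2+a_3)(a_1+a_2+a_3+2a_1a_2a_3)+\tfrac83(a_1a_2+a_2a_3+a_3a_1)}-a_1-a_2-a_3\Big),$$ $$UB_2(\boldsymbol{a}) := \tfrac12\Big(\sqrt{a_1a_2a_3(a_1+a_2+a_3)}-a_1-a_2-a_3\Big).$$ Then the maximum $F(\boldsymbol{a})$ exists, $F(\boldsymbol{a}) \le UB_1(\boldsymbol{a})$ and $F(\boldsymbol{a}) \le UB_2(\boldsymbol{a})$. Moreover, if $a_1 < a_2$ (that is, if $a_1=a_2=1$ is excluded),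 then $UB_2(\boldsymbol{a})$ is sharper, $UB_2(\boldsymbol{a}) < UB_1(\boldsymbol{a})$, only when $$ \begin{aligned} (a_1, a_2, a_3) \in \big\{ &(1,2,3),(1,2,5),(1,2,7),(1,2,9),(1,2,11),(1,2,13),(1,2,15),\\ &(1,2,17),(1,2,19),(1,2,21),(1,2,23),(1,2,25),(1,3,4),(1,3,5),\\ &(1,3,7),(1,3,8),(1,3,10),(1,3,11),(1,3,13),(1,3,14),(1,4,5),\\ &(1,4,7),(1,4,9),(1,4,11),(1,5,6),(1,5,7),(1,5,8),(1,5,9),(1,6,7),(2,3,5)\big\}, \end{aligned} $$ and these thirty triples are exactly the ones for which $UB_2(\boldsymbol{a}) \le UB_1(\boldsymbol{a})$. -/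

import Mathlib

/-- The integers that are not nonnegative integer combinations `∑ i, a i * z i` of the entries
of `a`. All negative integers belong to it when the entries of `a` are positive. -/
def nonRepresentable {n : ℕ} (a : Fin n → ℤ) : Set ℤ :=
  {b : ℤ | ∀ z : Fin n → ℤ, (∀ i, 0 ≤ z i) → b ≠ ∑ i, a i * z i}

/-- The Frobenius number: the maximum of `nonRepresentable a` (the value is meaningful when this
maximum exists). It equals `-1` when some entry is `1` and all are positive. -/
noncomputable def frobeniusNumber {n : ℕ} (a : Fin n → ℤ) : ℤ :=
  sSup (nonRepresentable a)

noncomputable def UB₁ (x y z : ℝ) : ℝ :=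
  1 / 2 * (Real.sqrt (1 / 3 * (x + y + z) * (x + y + z + 2 * x * y * z)
    + 8 / 3 * (x * y + y * z + z * x)) - x - y - z)

noncomputable def UB₂ (x y z : ℝ) : ℝ :=
  1 / 2 * (Real.sqrt (x * y * z * (x + y + z)) - x - y - z)

/-- The thirty exceptional triples. -/
def exceptionalTriples : Finset (ℤ × ℤ × ℤ) :=
  {(1, 2, 3), (1, 2, 5), (1, 2, 7), (1, 2, 9), (1, 2, 11), (1, 2, 13), (1, 2, 15),
   (1, 2, 17), (1, 2, 19), (1, 2, 21), (1, 2, 23), (1, 2, 25), (1, 3, 4), (1, 3, 5),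
   (1, 3, 7), (1, 3, 8), (1, 3, 10), (1, 3, 11), (1, 3, 13), (1, 3, 14), (1, 4, 5),
   (1, 4, 7), (1, 4, 9), (1, 4, 11), (1, 5, 6), (1, 5, 7), (1, 5, 8), (1, 5, 9),
   (1, 6, 7), (2, 3, 5)}

/-!
Write `a ≤ b ≤ c` for the three smallest entries; an integer not representable by all entries is not
representable by these three, so upper bounds only have to be proved for such an integer `m`.

The key step is an averaging argument. For `0 ≤ k < a` write `m - c k = a x_k + b y_k` with
`0 ≤ y_k < a`. As `m` is not representable, `x_k ≤ -1`. Coprimality of `a` and `c` makes the `y_k`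
distinct, and coprimality of `b` and `c` together with `a ≤ b` makes the `x_k` distinct. Hence
`∑ y_k ≤ 0 + 1 + ⋯ + (a - 1)` and `∑ (-x_k) ≥ 1 + 2 + ⋯ + a`, and adding up the `a` equations yields
`2 m + a + b + c ≤ a (b + c - a)` (`two_mul_add_le_of_not_representable`). The equation for `k = 0`
alone gives the two-generator bound `m ≤ a b - a - b` (`le_of_not_representable`), which also shows
that the maximum exists.

Since `a (b + c - a) ≤ b c`, the averaged bound squares to `a b c (b + c - a)`, which is at
most the radicand of `UB₂`, and at most that of `UB₁` when `b + c ≤ 5 a`. In the remaining case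
`5 a ≤ b + c` the two-generator bound is already below `UB₁`.

Finally `UB₂ ≤ UB₁` amounts to `a b c s ≤ s² + 8 (a b + b c + c a)` with `s = a + b + c`. As
`3 (a b + b c + c a) ≤ s²`, this forces `3 a b c ≤ 11 s`, hence `a b ≤ 10`, and leaves finitely many
triples.
-/

/-! ### Upper bounds for integers not representable by three numbers -/

/-- Every integer is an integer combination of coprime `a > 0` and `b` in which the coefficient of
`b` is reduced modulo `a`. -/
lemma exists_eq_mul_add_mul_of_gcd_eq_one {a b : ℤ} (ha : 0 < a) (hab : Int.gcd a b = 1) (m : ℤ) :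
    ∃ x y : ℤ, 0 ≤ y ∧ y < a ∧ m = a * x + b * y := by
  have hb := Int.gcd_eq_gcd_ab a b
  rw [hab] at hb
  push_cast at hb
  refine ⟨Int.gcdA a b * m + b * (Int.gcdB a b * m / a), Int.gcdB a b * m % a,
    Int.emod_nonneg _ ha.ne', Int.emod_lt_of_pos _ ha, ?_⟩
  have h := Int.mul_ediv_add_emod (Int.gcdB a b * m) a
  linear_combination m * hb - b * h

/-- Distinct integers bounded below by `l` have sum at least `l + (l + 1) + ⋯`. -/
lemma card_mul_le_two_mul_sum {ι : Type*} {s : Finset ι} {f : ι → ℤ} {l : ℤ}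
    (hf : ∀ k ∈ s, l ≤ f k) (hinj : Set.InjOn f s) :
    (s.card : ℤ) * (2 * l + s.card - 1) ≤ 2 * ∑ k ∈ s, f k := by
  classical
  have h := Finset.sum_range_le_sum (s := s.image f) (c := l) (by simpa using hf)
  rw [Finset.card_image_of_injOn hinj, Finset.sum_image hinj] at h
  have hr : ∀ n : ℕ, 2 * ∑ i ∈ Finset.range n, (l + (i : ℤ)) = n * (2 * l + n - 1) := fun n ↦ by
    induction n with
    | zero => simp
    | succ n ih => rw [Finset.sum_range_succ, mul_add, ih]; push_cast; ring
  linarith [hr s.card]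

/-- Sylvester's bound on the integers not representable by two coprime numbers. -/
lemma le_of_not_representable {a b m : ℤ} (ha : 0 < a) (hb : 0 < b) (hab : Int.gcd a b = 1)
    (hm : ∀ x y : ℤ, 0 ≤ x → 0 ≤ y → m ≠ a * x + b * y) : m ≤ a * b - a - b := by
  obtain ⟨x, y, hy₀, hya, h⟩ := exists_eq_mul_add_mul_of_gcd_eq_one ha hab m
  have hx : x ≤ -1 := by
    by_contra! hx
    exact hm x y (by omega) hy₀ h
  have hy : y ≤ a - 1 := by omega
  linarith [mul_le_mul_of_nonneg_left hx ha.le, mul_le_mul_of_nonneg_left hy hb.le]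

/-- The averaged bound: for `0 ≤ k < a` write `m - c k = a x_k + b y_k` with `0 ≤ y_k < a`; then the
`-x_k` are distinct positive integers, the `y_k` are distinct, and the `a` equations are added up. -/
lemma two_mul_add_le_of_not_representable {a b c m : ℤ} (ha : 0 < a) (hle : a ≤ b) (hc : 0 < c)
    (hab : Int.gcd a b = 1) (hac : Int.gcd a c = 1) (hbc : Int.gcd b c = 1)
    (hm : ∀ x y z : ℤ, 0 ≤ x → 0 ≤ y → 0 ≤ z → m ≠ a * x + b * y + c * z) :
    2 * m + (a + b + c) ≤ a * (b + c - a) := by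
  have hb : 0 < b := ha.trans_le hle
  choose x y hy₀ hya h using
    fun k : ℕ ↦ exists_eq_mul_add_mul_of_gcd_eq_one ha hab (m - c * k)
  lift a to ℕ using ha.le
  have hx : ∀ k, 1 ≤ -x k := fun k ↦ by
    by_contra! hx
    exact hm (x k) (y k) k (by omega) (hy₀ k) (by positivity) (by linarith [h k])
  -- Indices below `a` that agree modulo a number `d ≥ a` are equal.
  have hfin : ∀ d : ℤ, a ≤ d → ∀ i ∈ Finset.range a, ∀ j ∈ Finset.range a,
      d ∣ (i : ℤ) - j → i = j := fun d hd i hi j hj hdvd ↦ by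
    rw [Finset.mem_range] at hi hj
    have := Int.eq_zero_of_abs_lt_dvd hdvd (by rw [abs_lt]; omega)
    omega
  have hyinj : Set.InjOn y (Finset.range a) := fun i hi j hj hij ↦ by
    refine hfin a le_rfl i hi j hj (IsCoprime.dvd_of_dvd_mul_left (Int.isCoprime_iff_gcd_eq_one.2 hac)
      ⟨x j - x i, ?_⟩)
    linear_combination h j - h i - b * hij
  have hxinj : Set.InjOn (fun k ↦ -x k) (Finset.range a) := fun i hi j hj hij ↦ by
    refine hfin b hle i hi j hj (IsCoprime.dvd_of_dvd_mul_left (Int.isCoprime_iff_gcd_eq_one.2 hbc)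
      ⟨y j - y i, ?_⟩)
    linear_combination h j - h i + (a : ℤ) * hij
  -- The `y k` are at most `a - 1`, so the lower bound for sums applies to the `-y k`.
  have hysum := card_mul_le_two_mul_sum (f := fun k ↦ -y k) (l := 1 - a)
    (fun k _ ↦ by linarith [hya k]) (fun i hi j hj hij ↦ hyinj hi hj (neg_injective hij))
  have hxsum := card_mul_le_two_mul_sum (fun k _ ↦ hx k) hxinj
  have hksum := card_mul_le_two_mul_sum (s := Finset.range a) (f := fun k ↦ -(k : ℤ)) (l := 1 - a)
    (fun k hk ↦ by rw [Finset.mem_range] at hk; omega) (fun i _ j _ hij ↦ by simpa using hij)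
  have hsum : a * m = a * ∑ k ∈ Finset.range a, x k + b * ∑ k ∈ Finset.range a, y k
      + c * ∑ k ∈ Finset.range a, (k : ℤ) := by
    rw [Finset.mul_sum, Finset.mul_sum, Finset.mul_sum, ← Finset.sum_add_distrib,
      ← Finset.sum_add_distrib, ← Finset.sum_congr rfl fun k _ ↦ by rw [← h k, sub_add_cancel]]
    simp
  simp only [Finset.sum_neg_distrib, Finset.card_range] at hxsum hysum hksum
  refine le_of_mul_le_mul_left ?_ ha
  linarith [mul_le_mul_of_nonneg_left hxsum ha.le, mul_le_mul_of_nonneg_left hysum hb.le,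
    mul_le_mul_of_nonneg_left hksum hc.le]

/-! ### Comparison with the two square roots -/

lemma le_UB₂_of_two_mul_add_le {m a b c : ℝ} (ha : 0 < a) (hab : a ≤ b) (hbc : b ≤ c)
    (h : 2 * m + (a + b + c) ≤ a * (b + c - a)) : m ≤ UB₂ a b c := by
  have hu : a * (b + c - a) ≤ b * c := by nlinarith
  have hu₀ : 0 ≤ a * (b + c - a) := mul_nonneg ha.le (by linarith)
  have hP : 0 < a * b * c := mul_pos (mul_pos ha (by linarith)) (by linarith)
  have hs : a * (b + c - a) ≤ √(a * b * c * (a + b + c)) := by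
    refine Real.le_sqrt_of_sq_le ?_
    calc (a * (b + c - a)) ^ 2 = a * (b + c - a) * (a * (b + c - a)) := sq _
      _ ≤ b * c * (a * (b + c - a)) := mul_le_mul_of_nonneg_right hu hu₀
      _ = a * b * c * (b + c - a) := by ring
      _ ≤ a * b * c * (a + b + c) := mul_le_mul_of_nonneg_left (by linarith) hP.le
  unfold UB₂
  linarith

lemma le_UB₁_of_two_mul_add_le {m a b c : ℝ} (ha : 1 ≤ a) (hab : a ≤ b) (hbc : b ≤ c)
    (h : 2 * m + (a + b + c) ≤ a * (b + c - a)) (h' : m ≤ a * b - a - b) : m ≤ UB₁ a b c := by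
  have ha₀ : 0 < a := by linarith
  have hb₀ : 0 < b := by linarith
  have hc₀ : 0 < c := by linarith
  have hP : 0 < a * b * c := by positivity
  suffices hs : 2 * m + (a + b + c) ≤ √(1 / 3 * (a + b + c) * (a + b + c + 2 * a * b * c)
      + 8 / 3 * (a * b + b * c + c * a)) by
    unfold UB₁
    linarith
  have hq : 0 < a * b + b * c + c * a := by positivity
  rcases le_total (b + c) (5 * a) with h5 | h5
  · have hu : a * (b + c - a) ≤ b * c := by nlinarith
    have hu₀ : 0 ≤ a * (b + c - a) := mul_nonneg ha₀.le (by linarith)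
    refine h.trans (Real.le_sqrt_of_sq_le ?_)
    calc (a * (b + c - a)) ^ 2 = a * (b + c - a) * (a * (b + c - a)) := sq _
      _ ≤ b * c * (a * (b + c - a)) := mul_le_mul_of_nonneg_right hu hu₀
      _ = a * b * c * (b + c - a) := by ring
      _ ≤ a * b * c * (2 / 3 * (a + b + c)) := mul_le_mul_of_nonneg_left (by linarith) hP.le
      _ ≤ _ := by nlinarith [sq_nonneg (a + b + c)]
  · have hm : 2 * m + (a + b + c) ≤ 2 * (a * b) + (c - a - b) := by linarith
    refine hm.trans (Real.le_sqrt_of_sq_le ?_)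
    have hp : 0 < a * b := by positivity
    rcases le_total c (a + b) with ht | ht
    · have h₀ : 0 ≤ 2 * (a * b) + (c - a - b) := by nlinarith
      calc (2 * (a * b) + (c - a - b)) ^ 2 ≤ (2 * (a * b)) ^ 2 :=
            pow_le_pow_left₀ h₀ (by linarith) 2
        _ = a * b * b * (4 * a) := by ring
        _ ≤ a * b * c * (4 * a) := by gcongr
        _ ≤ a * b * c * (2 / 3 * (a + b + c)) := mul_le_mul_of_nonneg_left (by linarith) hP.le
        _ ≤ _ := by nlinarith [sq_nonneg (a + b + c)]
    · -- With `t = c - a - b ≥ 0`, compare the coefficients of `1`, `t` and `t ^ 2`.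
      obtain ⟨t, rfl⟩ : ∃ t, c = a + b + t := ⟨c - a - b, by ring⟩
      have ht₀ : 0 ≤ t := by linarith
      have h₁ : 0 ≤ a * b * ((a + b) ^ 2 - 4 * (a * b)) :=
        mul_nonneg hp.le (by nlinarith [sq_nonneg (a - b)])
      have h₂ : 0 ≤ a * b * t * (a + b - 2) :=
        mul_nonneg (mul_nonneg hp.le ht₀) (by linarith)
      have h₃ : 0 ≤ (a * b - 1) * t ^ 2 := mul_nonneg (by nlinarith) (sq_nonneg t)
      have h₄ : 0 ≤ (a + b) * t := by positivity
      nlinarith [sq_nonneg (a + b), sq_nonneg (a * b)]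

/-! ### The triples for which the second bound is at least as sharp -/

/-- The two radicands are compared, and a common factor `1 / 3` drops out. -/
lemma UB₂_le_UB₁_iff {a b c : ℝ} (ha : 0 < a) (hb : 0 < b) (hc : 0 < c) :
    UB₂ a b c ≤ UB₁ a b c ↔
      a * b * c * (a + b + c) ≤ (a + b + c) ^ 2 + 8 * (a * b + b * c + c * a) := by
  have h : UB₂ a b c ≤ UB₁ a b c ↔ √(a * b * c * (a + b + c)) ≤
      √(1 / 3 * (a + b + c) * (a + b + c + 2 * a * b * c) + 8 / 3 * (a * b + b * c + c * a)) := by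
    unfold UB₁ UB₂
    constructor <;> intro h <;> linarith
  rw [h, Real.sqrt_le_sqrt_iff (by positivity)]
  constructor <;> intro h <;> nlinarith

/-- The inequality to which `UB₂ ≤ UB₁` reduces has only the exceptional triples as solutions. The
bound `3 (a b + b c + c a) ≤ (a + b + c) ^ 2` gives `3 a b c ≤ 11 (a + b + c) < 33 c`, hence
`a b ≤ 10`; then `c ≤ 25` since, for fixed `a` and `b`, the inequality is quadratic in `c`. -/
lemma mem_exceptionalTriples_iff {a b c : ℤ} (ha : 0 < a) (hlt : a < b) (hbc : b ≤ c)
    (hab : Int.gcd a b = 1) (hac : Int.gcd a c = 1) (hgbc : Int.gcd b c = 1) :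
    a * b * c * (a + b + c) ≤ (a + b + c) ^ 2 + 8 * (a * b + b * c + c * a) ↔
      (a, b, c) ∈ exceptionalTriples := by
  constructor
  · intro h
    have hs : 0 < a + b + c := by linarith
    have hP : 3 * (a * b * c) ≤ 11 * (a + b + c) := by
      refine le_of_mul_le_mul_right ?_ hs
      nlinarith [sq_nonneg (a - b), sq_nonneg (b - c), sq_nonneg (a - c)]
    have hp : a * b < 11 := by
      have hc : 0 < c := by linarith
      refine lt_of_mul_lt_mul_right (a := c) ?_ hc.le
      linarith
    have hb : b ≤ 10 := by nlinarith
    have ha' : a ≤ 2 := by nlinarith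
    have hc : c ≤ 25 := by
      by_contra! hc
      interval_cases a <;> interval_cases b <;> nlinarith
    interval_cases a <;> interval_cases b <;> first
      | (exfalso; revert hab; decide)
      | (interval_cases c <;> first
          | decide
          | (exfalso; revert h; decide)
          | (exfalso; revert hgbc; decide)
          | (exfalso; revert hac; decide))
  · intro h
    simp only [exceptionalTriples, Finset.mem_insert, Finset.mem_singleton, Prod.mk.injEq] at h
    rcases h with h | h | h | h | h | h | h | h | h | h | h | h | h | h | h | h | h | h | h | h | h |
      h | h | h | h | h | h | h | h | h <;> obtain ⟨rfl, rfl, rfl⟩ := h <;> norm_num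

/-! ### The bounds for all the entries -/

theorem mainTheorem3 (n : ℕ) (hn : 3 ≤ n) (a : Fin n → ℤ)
    (hpos : ∀ i, 0 < a i)
    (hcop : ∀ i j, i ≠ j → Int.gcd (a i) (a j) = 1)
    (hmono : Monotone a)
    (a₁ a₂ a₃ : ℤ)
    (h₁ : a₁ = a ⟨0, by omega⟩) (h₂ : a₂ = a ⟨1, by omega⟩) (h₃ : a₃ = a ⟨2, by omega⟩) :
    IsGreatest (nonRepresentable a) (frobeniusNumber a) ∧
    (frobeniusNumber a : ℝ) ≤ UB₁ a₁ a₂ a₃ ∧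
    (frobeniusNumber a : ℝ) ≤ UB₂ a₁ a₂ a₃ ∧
    (a₁ < a₂ →
      (UB₂ a₁ a₂ a₃ < UB₁ a₁ a₂ a₃ → (a₁, a₂, a₃) ∈ exceptionalTriples) ∧
      (UB₂ a₁ a₂ a₃ ≤ UB₁ a₁ a₂ a₃ ↔ (a₁, a₂, a₃) ∈ exceptionalTriples)) := by
  have h01 : a₁ ≤ a₂ := by rw [h₁, h₂]; exact hmono (by simp)
  have h12 : a₂ ≤ a₃ := by rw [h₂, h₃]; exact hmono (by simp)
  have hp : 0 < a₁ := h₁ ▸ hpos _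
  have g01 : Int.gcd a₁ a₂ = 1 := by rw [h₁, h₂]; exact hcop _ _ (by simp)
  have g02 : Int.gcd a₁ a₃ = 1 := by rw [h₁, h₃]; exact hcop _ _ (by simp)
  have g12 : Int.gcd a₂ a₃ = 1 := by rw [h₂, h₃]; exact hcop _ _ (by simp)
  have hthree : ∀ m ∈ nonRepresentable a, ∀ x y z : ℤ, 0 ≤ x → 0 ≤ y → 0 ≤ z →
      m ≠ a₁ * x + a₂ * y + a₃ * z := by
    intro m hm x y z hx hy hz heq
    refine hm (Pi.single ⟨0, by omega⟩ x + Pi.single ⟨1, by omega⟩ y + Pi.single ⟨2, by omega⟩ z)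
      (fun i ↦ ?_) ?_
    · have hsingle : ∀ (j : Fin n) (v : ℤ), 0 ≤ v → 0 ≤ (Pi.single j v : Fin n → ℤ) i :=
        fun j v hv ↦ by
          rw [Pi.single_apply]
          split_ifs <;> simp [hv]
      exact add_nonneg (add_nonneg (hsingle _ x hx) (hsingle _ y hy)) (hsingle _ z hz)
    · simp [mul_add, Finset.sum_add_distrib, Pi.single_apply, heq, h₁, h₂, h₃]
  have hbound : ∀ m ∈ nonRepresentable a, m ≤ a₁ * a₂ - a₁ - a₂ := fun m hm ↦
    le_of_not_representable hp (hp.trans_le h01) g01 fun x y hx hy heq ↦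
      hthree m hm x y 0 hx hy le_rfl (by simpa using heq)
  have hne : (-1 : ℤ) ∈ nonRepresentable a := fun z hz heq ↦ by
    have : 0 ≤ ∑ i, a i * z i := Finset.sum_nonneg fun i _ ↦ mul_nonneg (hpos i).le (hz i)
    omega
  have hbdd : BddAbove (nonRepresentable a) := ⟨_, hbound⟩
  have hmem : frobeniusNumber a ∈ nonRepresentable a := Int.csSup_mem ⟨_, hne⟩ hbdd
  have hF := two_mul_add_le_of_not_representable hp h01 (by omega) g01 g02 g12 (hthree _ hmem)
  have hF' := hbound _ hmem
  have hpR : (1 : ℝ) ≤ a₁ := by exact_mod_cast hp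
  have h01R : (a₁ : ℝ) ≤ a₂ := by exact_mod_cast h01
  have h12R : (a₂ : ℝ) ≤ a₃ := by exact_mod_cast h12
  have hFR : 2 * (frobeniusNumber a : ℝ) + (a₁ + a₂ + a₃) ≤ a₁ * (a₂ + a₃ - a₁) := by
    exact_mod_cast hF
  have hFR' : (frobeniusNumber a : ℝ) ≤ a₁ * a₂ - a₁ - a₂ := by exact_mod_cast hF'
  refine ⟨⟨hmem, fun m hm ↦ le_csSup hbdd hm⟩, le_UB₁_of_two_mul_add_le hpR h01R h12R hFR hFR',
    le_UB₂_of_two_mul_add_le (by linarith) h01R h12R hFR, fun hlt ↦ ?_⟩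
  have hiff : UB₂ a₁ a₂ a₃ ≤ UB₁ a₁ a₂ a₃ ↔ (a₁, a₂, a₃) ∈ exceptionalTriples := by
    rw [UB₂_le_UB₁_iff (by linarith) (by linarith) (by linarith),
      ← mem_exceptionalTriples_iff hp hlt h12 g01 g02 g12]
    norm_cast
  exact ⟨fun h ↦ hiff.1 h.le, hiff⟩
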